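/- **Theorem 1.** Let $n$ be a natural number, let $\nu>0$ be real, let $B$ be a real $n\times n$ matrix, and let $\Sigma_1,\Sigma_2$ be real symmetric positive definite $n\times n$ matrices. Write $|\cdot|$ for the determinant, $\mathrm{etr}(\cdot)=\exp(\mathrm{tr}(\cdot))$, and $\Gamma_n(z)=\pi^{n(n-1)/4}\prod_{i=1}^n\Gamma\bigl(z-\tfrac12(i-1)\bigr)$ for the multivariate gamma function. Let $W$ and $Y$ be random real $n\times n$ matrices on a common probability space such that (i) $W\sim\mathcal{IMG}_n\bigl(\tfrac{\nu+n-1}{2},2,\Sigma_1\bigr)$, where the inverted matrix variate gamma distribution $\mathcal{IMG}_n(\delta,\beta,\Psi)$ is the distribution on symmetric positive definite matrices $w$ with density $$\frac{|\Psi|^{\delta}}{\beta^{n\delta}\,\Gamma_n(\delta)}\,|w|^{-\delta-\frac{n+1}{2}}\,\mathrm{etr}\Bigl(-\tfrac1\beta\,\Psi\,w^{-1}\Bigr)$$ with respect to Lebesgue measure $\prod_{i\le j}dw_{ij}$ on symmetric matrices; (ii) conditionally on $W$, $Y\mid W\sim N_{n,n}(B,W,\Sigma_2)$, i.e. for almost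 every value $w$ of $W$ (with respect to the law of $W$) the conditional distribution of $Y$ given $W=w$ is the matrix variate normal distribution with density $$y\mapsto\frac{|w|^{-n/2}|\Sigma_2|^{-n/2}}{(2\pi)^{n^2/2}}\,\mathrm{etr}\Bigl(-\tfrac12\,\Sigma_2^{-1}(y-B)'\,w^{-1}(y-B)\Bigr)$$ with respect to Lebesgue measure on $\mathbb{R}^{n\times n}$. Then $Y$ is marginally matrix variate $t$, $Y\sim t_{n,n}(\nu,B,\Sigma_1,\Sigma_2)$; that is, $Y$ has density $$y\mapsto\frac{\Gamma_n\bigl(\frac{\nu+2n-1}{2}\bigr)}{\pi^{n^2/2}\,\Gamma_n\bigl(\frac{\nu+n-1}{2}\bigr)}\,|\Sigma_1|^{-n/2}|\Sigma_2|^{-n/2}\,\bigl|I_n+\Sigma_1^{-1}(y-B)\Sigma_2^{-1}(y-B)'\bigr|^{-\frac{\nu+2n-1}{2}}$$ with respect to Lebesgue measure on $\mathbb{R}^{n\times n}$. -/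

import Mathlib

open MeasureTheory ProbabilityTheory
open scoped Matrix

namespace MatrixT

/-- The product (equivalently Borel) σ-algebra on real matrices. -/
instance instMeasurableSpaceMatrix {m n : ℕ} : MeasurableSpace (Matrix (Fin m) (Fin n) ℝ) :=
  inferInstanceAs (MeasurableSpace (Fin m → Fin n → ℝ))

/-- Lebesgue measure `∏ i j, dx i j` on real matrices. -/
noncomputable instance instMeasureSpaceMatrix {m n : ℕ} :
    MeasureSpace (Matrix (Fin m) (Fin n) ℝ) :=
  inferInstanceAs (MeasureSpace (Fin m → Fin n → ℝ))

instance instBorelSpaceMatrix {m n : ℕ} : BorelSpace (Matrix (Fin m) (Fin n) ℝ) :=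
  inferInstanceAs (BorelSpace (Fin m → Fin n → ℝ))

instance instStandardBorelSpaceMatrix {m n : ℕ} :
    StandardBorelSpace (Matrix (Fin m) (Fin n) ℝ) :=
  inferInstanceAs (StandardBorelSpace (Fin m → Fin n → ℝ))

/-- The multivariate gamma function
`Γ_p(z) = π^(p(p-1)/4) ∏_{i=1}^p Γ(z - (i-1)/2)`; here `i` runs over `0, …, p-1`. -/
noncomputable def multiGamma (p : ℕ) (z : ℝ) : ℝ :=
  Real.pi ^ ((p : ℝ) * ((p : ℝ) - 1) / 4) *
    ∏ i ∈ Finset.range p, Real.Gamma (z - (i : ℝ) / 2)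

/-- The symmetric matrix whose entries on and above the diagonal are the given numbers. -/
def symMatrixOf {n : ℕ} (x : {p : Fin n × Fin n // p.1 ≤ p.2} → ℝ) :
    Matrix (Fin n) (Fin n) ℝ :=
  Matrix.of fun i j => x ⟨(min i j, max i j), min_le_max⟩

/-- Lebesgue measure `∏_{i ≤ j} dx i j` on symmetric matrices, as a measure on all matrices that
is carried by the symmetric ones. -/
noncomputable def symVolume (n : ℕ) : Measure (Matrix (Fin n) (Fin n) ℝ) :=
  (volume : Measure ({p : Fin n × Fin n // p.1 ≤ p.2} → ℝ)).map symMatrixOf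

/-- Density of the inverted matrix variate gamma distribution `IMG_n(δ, β, Ψ)` at a positive
definite `W`:
`|Ψ|^δ / (β^(nδ) Γ_n(δ)) · |W|^(-δ-(n+1)/2) · etr(-(1/β) Ψ W⁻¹)`. -/
noncomputable def invMatrixGammaPDF {n : ℕ} (δ β : ℝ) (Ψ W : Matrix (Fin n) (Fin n) ℝ) : ℝ :=
  Ψ.det ^ δ / (β ^ ((n : ℝ) * δ) * multiGamma n δ) *
    W.det ^ (-δ - ((n : ℝ) + 1) / 2) * Real.exp (-(1 / β) * (Ψ * W⁻¹).trace)

/-- The inverted matrix variate gamma distribution `IMG_n(δ, β, Ψ)`, a measure on positive definite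
matrices. -/
noncomputable def invMatrixGamma {n : ℕ} (δ β : ℝ) (Ψ : Matrix (Fin n) (Fin n) ℝ) :
    Measure (Matrix (Fin n) (Fin n) ℝ) :=
  ((symVolume n).restrict {W | W.PosDef}).withDensity
    fun W => ENNReal.ofReal (invMatrixGammaPDF δ β Ψ W)

/-- Density of the matrix variate normal distribution `N_{n,n}(M, Ω₁, Ω₂)`:
`|Ω₁|^(-n/2) |Ω₂|^(-n/2) / (2π)^(n²/2) · etr(-(1/2) Ω₂⁻¹ (X - M)' Ω₁⁻¹ (X - M))`. -/
noncomputable def matrixNormalPDF {n : ℕ} (M Ω₁ Ω₂ X : Matrix (Fin n) (Fin n) ℝ) : ℝ :=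
  Ω₁.det ^ (-(n : ℝ) / 2) * Ω₂.det ^ (-(n : ℝ) / 2) / (2 * Real.pi) ^ ((n : ℝ) ^ 2 / 2) *
    Real.exp (-(1 / 2) * (Ω₂⁻¹ * (X - M)ᵀ * Ω₁⁻¹ * (X - M)).trace)

/-- The matrix variate normal distribution `N_{n,n}(M, Ω₁, Ω₂)` (for positive definite
`Ω₁, Ω₂`). -/
noncomputable def matrixNormal {n : ℕ} (M Ω₁ Ω₂ : Matrix (Fin n) (Fin n) ℝ) :
    Measure (Matrix (Fin n) (Fin n) ℝ) :=
  volume.withDensity fun X => ENNReal.ofReal (matrixNormalPDF M Ω₁ Ω₂ X)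

/-- Density of the matrix variate t distribution `t_{n,n}(ν, M, Ω₁, Ω₂)`:
`Γ_n((ν+2n-1)/2) / (π^(n²/2) Γ_n((ν+n-1)/2)) · |Ω₁|^(-n/2) |Ω₂|^(-n/2)
  · |I + Ω₁⁻¹ (X - M) Ω₂⁻¹ (X - M)'|^(-(ν+2n-1)/2)`. -/
noncomputable def matrixTPDF {n : ℕ} (ν : ℝ) (M Ω₁ Ω₂ X : Matrix (Fin n) (Fin n) ℝ) : ℝ :=
  multiGamma n ((ν + 2 * (n : ℝ) - 1) / 2) /
      (Real.pi ^ ((n : ℝ) ^ 2 / 2) * multiGamma n ((ν + (n : ℝ) - 1) / 2)) *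
    Ω₁.det ^ (-(n : ℝ) / 2) * Ω₂.det ^ (-(n : ℝ) / 2) *
    (1 + Ω₁⁻¹ * (X - M) * Ω₂⁻¹ * (X - M)ᵀ).det ^ (-(ν + 2 * (n : ℝ) - 1) / 2)

/-- The matrix variate t distribution `t_{n,n}(ν, M, Ω₁, Ω₂)`. -/
noncomputable def matrixT {n : ℕ} (ν : ℝ) (M Ω₁ Ω₂ : Matrix (Fin n) (Fin n) ℝ) :
    Measure (Matrix (Fin n) (Fin n) ℝ) :=
  volume.withDensity fun X => ENNReal.ofReal (matrixTPDF ν M Ω₁ Ω₂ X)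

end MatrixT

/-
Up to factors free of `y` and `w`, the product of the two densities is the inverse gamma kernel in
`w` with scale `Σ₁ + (y - B) Σ₂⁻¹ (y - B)'` and exponent `(ν + 2n - 1) / 2`. The substitution
`w ↦ g w g'`, whose Jacobian on symmetric matrices is `|g|^(n + 1)`, shows that the integral of that
kernel over positive definite `w` depends on the scale only through a power of its determinant, so
the density of `Y` is a constant multiple of `|I + Σ₁⁻¹ (y - B) Σ₂⁻¹ (y - B)'|^(-(ν + 2n - 1) / 2)`.
The law of `Y` is a probability measure, so the constant is forced to be the reciprocal of the
integral of this kernel over `y`. That integral is found by integrating out one row of `y` at a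
time, which is a rank-one update of the determinant; the mass of the inverse gamma kernel is never
computed.
-/

namespace MatrixT

open scoped ENNReal

section LinearAlgebra

variable {ι κ : Type*} [Fintype ι] [DecidableEq ι]

theorem diagonal_update_one_mul_transvection {R : Type*} [CommRing R] {i j : ι} (hij : i ≠ j)
    (a c : R) :
    Matrix.diagonal (Function.update 1 i a) * Matrix.transvection i j c =
      Matrix.transvection i j (a * c) * Matrix.diagonal (Function.update 1 i a) := by
  ext k l
  rw [Matrix.diagonal_mul, Matrix.mul_diagonal]
  simp only [Matrix.transvection, Matrix.add_apply, Matrix.single_apply, Matrix.one_apply,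
    Function.update_apply, Pi.one_apply]
  grind

/- A transvection `t` satisfies `d t = t² d` for an invertible diagonal matrix `d`, so in a
commutative target the images of `t` and `t²` agree. -/
theorem map_transvection_eq_one {K M : Type*} [Field K] [NeZero (2 : K)] [CommMonoid M]
    (f : Matrix ι ι K →* M) {i j : ι} (hij : i ≠ j) (c : K) :
    f (Matrix.transvection i j c) = 1 := by
  set t := Matrix.transvection i j c
  set d : Matrix ι ι K := Matrix.diagonal (Function.update 1 i 2)
  have hd : IsUnit (f d) := by
    refine IsUnit.map f ((Matrix.isUnit_iff_isUnit_det _).2 (isUnit_iff_ne_zero.2 ?_))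
    simp [d, Matrix.det_diagonal, Finset.prod_update_of_mem, two_ne_zero]
  have ht : IsUnit (f t) := by
    refine IsUnit.map f ((Matrix.isUnit_iff_isUnit_det _).2 ?_)
    simp [t, Matrix.det_transvection_of_ne i j hij]
  have hdt : d * t = t * t * d := by
    rw [diagonal_update_one_mul_transvection hij, two_mul,
      ← Matrix.transvection_mul_transvection_same i j hij]
  have hft : f t * f d = f t * f t * f d := by
    rw [← map_mul f t t, ← map_mul f (t * t) d, ← hdt, map_mul, mul_comm]
  exact (ht.mul_left_cancel ((mul_one _).trans (hd.mul_right_cancel hft))).symm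

theorem monoidHom_eq_of_eq_diagonal {K M : Type*} [Field K] [NeZero (2 : K)] [CommMonoid M]
    {f g : Matrix ι ι K →* M} (h : ∀ D, f (Matrix.diagonal D) = g (Matrix.diagonal D))
    {A : Matrix ι ι K} (hA : A.det ≠ 0) : f A = g A := by
  refine Matrix.diagonal_transvection_induction_of_det_ne_zero (fun A => f A = g A) A hA
    (fun D _ => h D) ?_ fun A B _ _ hfA hfB => by rw [map_mul, map_mul, hfA, hfB]
  rintro ⟨i, j, hij, c⟩
  simp only [Matrix.TransvectionStruct.toMatrix_mk, map_transvection_eq_one _ hij]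

theorem det_mulLeftLinearMap {R : Type*} [CommRing R] [Fintype κ] (g : Matrix ι ι R) :
    LinearMap.det (mulLeftLinearMap κ R g) = g.det ^ Fintype.card κ := by
  let e := (Matrix.transposeLinearEquiv ι κ R R).trans (Matrix.ofLinearEquiv R).symm
  have he : e.toLinearMap ∘ₗ mulLeftLinearMap κ R g ∘ₗ e.symm.toLinearMap =
      LinearMap.pi fun i => Matrix.toLin' g ∘ₗ LinearMap.proj i := rfl
  calc LinearMap.det (mulLeftLinearMap κ R g)
      = LinearMap.det (LinearMap.pi fun i : κ => Matrix.toLin' g ∘ₗ LinearMap.proj i) := by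
        rw [← he, LinearMap.det_conj]
    _ = g.det ^ Fintype.card κ := by
        rw [LinearMap.det_pi, LinearMap.det_toLin', Finset.prod_const, Finset.card_univ]

theorem prod_mul_of_le {ι M : Type*} [Fintype ι] [LinearOrder ι] [CommMonoid M] (D : ι → M) :
    ∏ p : {p : ι × ι // p.1 ≤ p.2}, D p.1.1 * D p.1.2 = (∏ i, D i) ^ (Fintype.card ι + 1) := by
  calc ∏ p : {p : ι × ι // p.1 ≤ p.2}, D p.1.1 * D p.1.2
      = ∏ p : ι × ι, if p.1 ≤ p.2 then D p.1 * D p.2 else 1 := by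
        rw [← Finset.prod_filter, Finset.prod_subtype (p := fun p : ι × ι => p.1 ≤ p.2)
          (F := inferInstance) (f := fun p => D p.1 * D p.2)]
        simp
    _ = ∏ i, ∏ j, (if i ≤ j then D i else 1) * (if i ≤ j then D j else 1) := by
        rw [Fintype.prod_prod_type]
        refine Finset.prod_congr rfl fun i _ => Finset.prod_congr rfl fun j _ => ?_
        split_ifs <;> simp
    _ = (∏ i, ∏ j, if i ≤ j then D i else 1) * ∏ i, ∏ j, if j ≤ i then D i else 1 := by
        rw [Finset.prod_comm (f := fun i j => if j ≤ i then D i else 1)]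
        simp only [Finset.prod_mul_distrib]
    _ = ∏ i, ∏ j, D i * (if i = j then D i else 1) := by
        simp only [← Finset.prod_mul_distrib]
        refine Finset.prod_congr rfl fun i _ => Finset.prod_congr rfl fun j _ => ?_
        rcases lt_trichotomy i j with h | rfl | h
        · simp [h.le, h.not_ge, h.ne]
        · simp
        · simp [h.le, h.not_ge, h.ne']
    _ = (∏ i, D i) ^ (Fintype.card ι + 1) := by
        simp only [Finset.prod_mul_distrib, Finset.prod_const, Finset.prod_ite_eq,
          Finset.mem_univ, if_true, Finset.card_univ, Finset.prod_pow, pow_succ]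

theorem exists_isUnit_det_eq_mul_transpose {A : Matrix ι ι ℝ} (hA : A.PosDef) :
    ∃ g : Matrix ι ι ℝ, IsUnit g.det ∧ A = g * gᵀ := by
  open scoped MatrixOrder in
  obtain ⟨B, hB⟩ := CStarAlgebra.nonneg_iff_eq_star_mul_self.mp hA.posSemidef.nonneg
  rw [Matrix.star_eq_conjTranspose, Matrix.conjTranspose_eq_transpose_of_trivial] at hB
  have hdet : IsUnit (Bᵀ.det * B.det) := by
    rw [← Matrix.det_mul, ← hB]
    exact hA.det_pos.ne'.isUnit
  exact ⟨Bᵀ, isUnit_of_mul_isUnit_left hdet, by rw [hB, Matrix.transpose_transpose]⟩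

theorem abs_det_pow_eq_rpow_det_mul_transpose (g : Matrix ι ι ℝ) (k : ℕ) :
    |g.det| ^ k = (g * gᵀ).det ^ ((k : ℝ) / 2) := by
  rw [Matrix.det_mul, Matrix.det_transpose, ← abs_mul_abs_self, Real.mul_rpow (abs_nonneg _)
    (abs_nonneg _), ← Real.rpow_add_of_nonneg (abs_nonneg _) (by positivity) (by positivity),
    add_halves, Real.rpow_natCast]

variable [Fintype κ] [DecidableEq κ] {R : Type*} [CommRing R]

theorem det_add_vecMulVec_mulVec (g : Matrix ι ι R) (u : ι → R) :
    (g * gᵀ + Matrix.vecMulVec (g *ᵥ u) (g *ᵥ u)).det = (g * gᵀ).det * (1 + u ⬝ᵥ u) := by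
  have hfactor : g * gᵀ + Matrix.vecMulVec (g *ᵥ u) (g *ᵥ u) =
      g * (1 + Matrix.vecMulVec u u) * gᵀ := by
    rw [Matrix.mul_add, Matrix.add_mul, Matrix.mul_one, Matrix.mul_vecMulVec,
      Matrix.vecMulVec_mul, Matrix.vecMul_transpose]
  rw [hfactor, Matrix.det_mul, Matrix.det_mul, Matrix.vecMulVec_eq Unit,
    Matrix.det_one_add_replicateCol_mul_replicateRow, Matrix.det_mul]
  ring

theorem det_one_add_mul_inv_mul_transpose_mul_left {g : Matrix ι ι R} (hg : IsUnit g.det)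
    {S : Matrix κ κ R} (hS : IsUnit S.det) (Z : Matrix ι κ R) :
    (1 + (g * gᵀ)⁻¹ * (g * Z) * S⁻¹ * (g * Z)ᵀ).det * S.det = (S + Zᵀ * Z).det := by
  have hgt : IsUnit gᵀ.det := by rwa [Matrix.det_transpose]
  calc (1 + (g * gᵀ)⁻¹ * (g * Z) * S⁻¹ * (g * Z)ᵀ).det * S.det
      = (1 + gᵀ⁻¹ * (Z * S⁻¹ * Zᵀ * gᵀ)).det * S.det := by
        simp only [Matrix.mul_inv_rev, Matrix.transpose_mul, Matrix.mul_assoc,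
          Matrix.nonsing_inv_mul_cancel_left _ _ hg]
    _ = (1 + Z * (S⁻¹ * Zᵀ)).det * S.det := by
        rw [Matrix.det_one_add_mul_comm, Matrix.mul_nonsing_inv_cancel_right _ _ hgt,
          Matrix.mul_assoc]
    _ = (S + Zᵀ * Z).det := by
        rw [Matrix.det_one_add_mul_comm, mul_comm, ← Matrix.det_mul, Matrix.mul_add,
          Matrix.mul_one, Matrix.mul_assoc, Matrix.mul_nonsing_inv_cancel_left _ _ hS]

theorem det_add_eq_det_mul_det_one_add_inv_mul {A : Matrix ι ι R} (hA : IsUnit A.det)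
    (B : Matrix ι ι R) : (A + B).det = A.det * (1 + A⁻¹ * B).det := by
  rw [← Matrix.det_mul, Matrix.mul_add, Matrix.mul_one, Matrix.mul_nonsing_inv_cancel_left _ _ hA]

end LinearAlgebra

section Jacobians

theorem lintegral_comp_linearMap {E : Type*} [NormedAddCommGroup E] [NormedSpace ℝ E]
    [MeasurableSpace E] [BorelSpace E] [FiniteDimensional ℝ E] (μ : Measure E)
    [μ.IsAddHaarMeasure] {f : E →ₗ[ℝ] E} (hf : LinearMap.det f ≠ 0) {F : E → ℝ≥0∞}
    (hF : Measurable F) :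
    ∫⁻ x, F x ∂μ = ENNReal.ofReal |LinearMap.det f| * ∫⁻ x, F (f x) ∂μ := by
  have hf' : Measurable f := f.continuous_of_finiteDimensional.measurable
  rw [← lintegral_map hF hf', Measure.map_linearMap_addHaar_eq_smul_addHaar μ hf,
    lintegral_smul_measure, smul_eq_mul, ← mul_assoc, ← ENNReal.ofReal_mul (abs_nonneg _),
    ← abs_mul, mul_inv_cancel₀ hf, abs_one, ENNReal.ofReal_one, one_mul]

instance {m n : ℕ} : SFinite (volume : Measure (Matrix (Fin m) (Fin n) ℝ)) :=
  inferInstanceAs (SFinite (volume : Measure (Fin m → Fin n → ℝ)))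

instance {m n : ℕ} : SecondCountableTopology (Matrix (Fin m) (Fin n) ℝ) :=
  inferInstanceAs (SecondCountableTopology (Fin m → Fin n → ℝ))

theorem lintegral_mul_left {m n : ℕ} {g : Matrix (Fin m) (Fin m) ℝ} (hg : IsUnit g.det)
    {F : Matrix (Fin m) (Fin n) ℝ → ℝ≥0∞} (hF : Measurable F) :
    ∫⁻ X, F X = ENNReal.ofReal (|g.det| ^ n) * ∫⁻ X : Matrix (Fin m) (Fin n) ℝ, F (g * X) := by
  have hdet := det_mulLeftLinearMap (κ := Fin n) g
  rw [Fintype.card_fin] at hdet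
  rw [← abs_pow, ← hdet]
  exact lintegral_comp_linearMap (volume : Measure (Fin m → Fin n → ℝ))
    (hdet.trans_ne (pow_ne_zero n hg.ne_zero)) hF

variable {n : ℕ}

instance : SFinite (symVolume n) :=
  inferInstanceAs (SFinite (Measure.map _ _))

theorem symMatrixOf_transpose (x : {p : Fin n × Fin n // p.1 ≤ p.2} → ℝ) :
    (symMatrixOf x)ᵀ = symMatrixOf x := by
  ext i j
  simp only [symMatrixOf, Matrix.transpose_apply, Matrix.of_apply, min_comm, max_comm]

theorem symMatrixOf_apply_of_le (x : {p : Fin n × Fin n // p.1 ≤ p.2} → ℝ)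
    (p : {p : Fin n × Fin n // p.1 ≤ p.2}) : symMatrixOf x p.1.1 p.1.2 = x p := by
  simp only [symMatrixOf, Matrix.of_apply, min_eq_left p.2, max_eq_right p.2]

theorem symMatrixOf_injective :
    Function.Injective (symMatrixOf : ({p : Fin n × Fin n // p.1 ≤ p.2} → ℝ) → _) := by
  intro x y h
  funext p
  rw [← symMatrixOf_apply_of_le x, h, symMatrixOf_apply_of_le]

theorem measurable_symMatrixOf :
    Measurable (symMatrixOf : ({p : Fin n × Fin n // p.1 ≤ p.2} → ℝ) → _) :=
  measurable_pi_iff.2 fun _ => measurable_pi_iff.2 fun _ => measurable_pi_apply _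

/-- The congruence action `w ↦ g w gᵀ` on symmetric matrices, read in the coordinates of
`symMatrixOf`; its determinant is the Jacobian needed for integrals against `symVolume`. -/
def symCongr (g : Matrix (Fin n) (Fin n) ℝ) :
    ({p : Fin n × Fin n // p.1 ≤ p.2} → ℝ) →ₗ[ℝ] ({p : Fin n × Fin n // p.1 ≤ p.2} → ℝ) where
  toFun x p := (g * symMatrixOf x * gᵀ) p.1.1 p.1.2
  map_add' x y := by
    have hadd : symMatrixOf (x + y) = symMatrixOf x + symMatrixOf y := rfl
    funext p
    simp only [hadd, Matrix.mul_add, Matrix.add_mul, Matrix.add_apply, Pi.add_apply]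
  map_smul' c x := by
    have hsmul : symMatrixOf (c • x) = c • symMatrixOf x := rfl
    funext p
    simp only [hsmul, Matrix.mul_smul, Matrix.smul_mul, Matrix.smul_apply, Pi.smul_apply,
      RingHom.id_apply]

theorem symMatrixOf_symCongr (g : Matrix (Fin n) (Fin n) ℝ)
    (x : {p : Fin n × Fin n // p.1 ≤ p.2} → ℝ) :
    symMatrixOf (symCongr g x) = g * symMatrixOf x * gᵀ := by
  have hsymm : (g * symMatrixOf x * gᵀ)ᵀ = g * symMatrixOf x * gᵀ := by
    simp only [Matrix.transpose_mul, Matrix.transpose_transpose, symMatrixOf_transpose,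
      Matrix.mul_assoc]
  ext i j
  change (g * symMatrixOf x * gᵀ) (min i j) (max i j) = _
  rcases le_total i j with h | h
  · rw [min_eq_left h, max_eq_right h]
  · rw [min_eq_right h, max_eq_left h, ← Matrix.transpose_apply (g * symMatrixOf x * gᵀ), hsymm]

theorem det_symCongr_diagonal (D : Fin n → ℝ) :
    LinearMap.det (symCongr (Matrix.diagonal D)) = (Matrix.diagonal D).det ^ (n + 1) := by
  have hdiag : symCongr (Matrix.diagonal D) = Matrix.toLin' (Matrix.diagonal fun
      p : {p : Fin n × Fin n // p.1 ≤ p.2} => D p.1.1 * D p.1.2) := by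
    refine LinearMap.ext fun x => funext fun p => ?_
    rw [← symMatrixOf_apply_of_le (symCongr _ x), symMatrixOf_symCongr, Matrix.toLin'_apply,
      Matrix.mulVec_diagonal, Matrix.diagonal_transpose, Matrix.mul_diagonal,
      Matrix.diagonal_mul, symMatrixOf_apply_of_le, mul_right_comm]
  rw [hdiag, LinearMap.det_toLin', Matrix.det_diagonal, Matrix.det_diagonal, prod_mul_of_le,
    Fintype.card_fin]

theorem det_symCongr {g : Matrix (Fin n) (Fin n) ℝ} (hg : IsUnit g.det) :
    LinearMap.det (symCongr g) = g.det ^ (n + 1) := by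
  let φ : Matrix (Fin n) (Fin n) ℝ →* ℝ :=
    { toFun := fun g => LinearMap.det (symCongr g)
      map_one' := by
        have hone : symCongr (1 : Matrix (Fin n) (Fin n) ℝ) = LinearMap.id :=
          LinearMap.ext fun x => symMatrixOf_injective <| by
            rw [symMatrixOf_symCongr, Matrix.transpose_one, Matrix.one_mul, Matrix.mul_one,
              LinearMap.id_apply]
        rw [hone, LinearMap.det_id]
      map_mul' := fun a b => by
        have hmul : symCongr (a * b) = symCongr a ∘ₗ symCongr b :=
          LinearMap.ext fun x => symMatrixOf_injective <| by
            simp only [LinearMap.comp_apply, symMatrixOf_symCongr, Matrix.transpose_mul,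
              Matrix.mul_assoc]
        rw [hmul, LinearMap.det_comp] }
  exact monoidHom_eq_of_eq_diagonal (f := φ) (g := Matrix.detMonoidHom ^ (n + 1))
    det_symCongr_diagonal hg.ne_zero

theorem lintegral_symVolume_congr {g : Matrix (Fin n) (Fin n) ℝ} (hg : IsUnit g.det)
    {F : Matrix (Fin n) (Fin n) ℝ → ℝ≥0∞} (hF : Measurable F) :
    ∫⁻ w, F w ∂symVolume n =
      ENNReal.ofReal (|g.det| ^ (n + 1)) * ∫⁻ w, F (g * w * gᵀ) ∂symVolume n := by
  have hcongr : Continuous fun w : Matrix (Fin n) (Fin n) ℝ => g * w * gᵀ := by fun_prop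
  have hdet := (det_symCongr hg).trans_ne (pow_ne_zero _ hg.ne_zero)
  rw [symVolume, lintegral_map hF measurable_symMatrixOf,
    lintegral_map (f := fun w => F (g * w * gᵀ)) (hF.comp hcongr.measurable)
      measurable_symMatrixOf,
    lintegral_comp_linearMap volume (F := fun x => F (symMatrixOf x)) hdet
      (hF.comp measurable_symMatrixOf)]
  simp only [symMatrixOf_symCongr, det_symCongr hg, abs_pow]

theorem measurableSet_posDef : MeasurableSet {w : Matrix (Fin n) (Fin n) ℝ | w.PosDef} := by
  have hsplit : {w : Matrix (Fin n) (Fin n) ℝ | w.PosDef} =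
      ({w | wᵀ = w} ∩ ⋂ x : Fin n → ℝ, {w | 0 ≤ x ⬝ᵥ (w *ᵥ x)}) ∩ {w | w.det = 0}ᶜ := by
    ext w
    have hw : w.PosSemidef ↔ wᵀ = w ∧ ∀ x : Fin n → ℝ, 0 ≤ x ⬝ᵥ (w *ᵥ x) := by
      simp [Matrix.posSemidef_iff_dotProduct_mulVec, Matrix.IsHermitian]
    simp only [Set.mem_inter_iff, Set.mem_iInter, Set.mem_compl_iff, Set.mem_ofPred_eq, ← hw]
    exact ⟨fun h => ⟨h.posSemidef, h.det_pos.ne'⟩, fun h => h.1.posDef_iff_det_ne_zero.2 h.2⟩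
  rw [hsplit]
  refine MeasurableSet.inter (IsClosed.measurableSet ?_) (IsClosed.measurableSet ?_).compl
  · exact (isClosed_eq (by fun_prop) (by fun_prop)).inter
      (isClosed_iInter fun x => isClosed_le (by fun_prop) (by fun_prop))
  · exact isClosed_eq (by fun_prop) (by fun_prop)

theorem posDef_mul_mul_transpose_iff {g : Matrix (Fin n) (Fin n) ℝ} (hg : IsUnit g.det)
    (w : Matrix (Fin n) (Fin n) ℝ) : (g * w * gᵀ).PosDef ↔ w.PosDef := by
  have h := Matrix.IsUnit.posDef_star_right_conjugate_iff (x := w)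
    ((Matrix.isUnit_iff_isUnit_det g).2 hg)
  rwa [Matrix.star_eq_conjTranspose, Matrix.conjTranspose_eq_transpose_of_trivial] at h

theorem setLIntegral_posDef_symVolume_congr {g : Matrix (Fin n) (Fin n) ℝ} (hg : IsUnit g.det)
    {F : Matrix (Fin n) (Fin n) ℝ → ℝ≥0∞} (hF : Measurable F) :
    ∫⁻ w in {w | w.PosDef}, F w ∂symVolume n =
      ENNReal.ofReal (|g.det| ^ (n + 1)) *
        ∫⁻ w in {w | w.PosDef}, F (g * w * gᵀ) ∂symVolume n := by
  have hind : ∀ w : Matrix (Fin n) (Fin n) ℝ,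
      {w | w.PosDef}.indicator F (g * w * gᵀ) =
        {w | w.PosDef}.indicator (fun w => F (g * w * gᵀ)) w := fun w => by
    classical exact if_congr (posDef_mul_mul_transpose_iff hg w) rfl rfl
  rw [← lintegral_indicator measurableSet_posDef,
    lintegral_symVolume_congr hg (hF.indicator measurableSet_posDef)]
  simp only [hind, lintegral_indicator measurableSet_posDef]

end Jacobians

section StudentIntegral

theorem lintegral_ofReal_eq_ofReal_of_integral_eq {α : Type*} {_ : MeasurableSpace α}
    {μ : Measure α} {f : α → ℝ} (hf : 0 ≤ᵐ[μ] f) {c : ℝ} (hc : c ≠ 0) (h : ∫ x, f x ∂μ = c) :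
    ∫⁻ x, ENNReal.ofReal (f x) ∂μ = ENNReal.ofReal c := by
  have hint : Integrable f μ := not_imp_comm.1 integral_undef (h.trans_ne hc)
  rw [← ofReal_integral_eq_lintegral_ofReal hint hf, h]

theorem lintegral_rpow_mul_exp_neg_mul_Ioi {a r : ℝ} (ha : 0 < a) (hr : 0 < r) :
    ∫⁻ t in Set.Ioi (0 : ℝ), ENNReal.ofReal (t ^ (a - 1) * Real.exp (-(r * t))) =
      ENNReal.ofReal (r ^ (-a) * Real.Gamma a) := by
  refine lintegral_ofReal_eq_ofReal_of_integral_eq ?_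
    (mul_pos (Real.rpow_pos_of_pos hr _) (Real.Gamma_pos_of_pos ha)).ne' ?_
  · filter_upwards [ae_restrict_mem measurableSet_Ioi] with t ht
    exact mul_nonneg (Real.rpow_nonneg (Set.mem_Ioi.1 ht).le _) (Real.exp_pos _).le
  · rw [Real.integral_rpow_mul_exp_neg_mul_Ioi ha hr, one_div, Real.inv_rpow hr.le,
      Real.rpow_neg hr.le]

section InnerProductSpace

variable {V : Type*} [NormedAddCommGroup V] [InnerProductSpace ℝ V] [FiniteDimensional ℝ V]
  [MeasurableSpace V] [BorelSpace V]

theorem lintegral_exp_neg_mul_norm_sq {t : ℝ} (ht : 0 < t) :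
    ∫⁻ v : V, ENNReal.ofReal (Real.exp (-t * ‖v‖ ^ 2)) =
      ENNReal.ofReal ((Real.pi / t) ^ (Module.finrank ℝ V / 2 : ℝ)) :=
  lintegral_ofReal_eq_ofReal_of_integral_eq (ae_of_all _ fun _ => (Real.exp_pos _).le)
    (by positivity) (GaussianFourier.integral_rexp_neg_mul_sq_norm ht)

theorem lintegral_rpow_mul_exp_neg_one_add_norm_sq_mul (a : ℝ) {t : ℝ} (ht : 0 < t) :
    ∫⁻ v : V, ENNReal.ofReal (t ^ (a - 1) * Real.exp (-((1 + ‖v‖ ^ 2) * t))) =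
      ENNReal.ofReal (Real.pi ^ (Module.finrank ℝ V / 2 : ℝ)) * ENNReal.ofReal
        (t ^ (a - Module.finrank ℝ V / 2 - 1) * Real.exp (-(1 * t))) := by
  have hsplit : ∀ v : V, t ^ (a - 1) * Real.exp (-((1 + ‖v‖ ^ 2) * t)) =
      t ^ (a - 1) * Real.exp (-t) * Real.exp (-t * ‖v‖ ^ 2) := fun v => by
    rw [mul_assoc, ← Real.exp_add]
    ring_nf
  have hnonneg : 0 ≤ t ^ (a - 1) * Real.exp (-t) := by positivity
  simp only [hsplit, ENNReal.ofReal_mul hnonneg]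
  rw [lintegral_const_mul' _ _ ENNReal.ofReal_ne_top, lintegral_exp_neg_mul_norm_sq ht,
    ← ENNReal.ofReal_mul hnonneg, ← ENNReal.ofReal_mul (by positivity),
    Real.div_rpow Real.pi_pos.le ht.le, sub_right_comm a, Real.rpow_sub ht (a - 1), one_mul]
  ring_nf

/- Writing `(1 + ‖v‖²) ^ (-a) Γ(a)` as a gamma integral and exchanging the integrals leaves a
Gaussian integral over `V`. -/
theorem lintegral_one_add_norm_sq_rpow_neg {a : ℝ} (ha : (Module.finrank ℝ V : ℝ) / 2 < a) :
    ∫⁻ v : V, ENNReal.ofReal ((1 + ‖v‖ ^ 2) ^ (-a)) = ENNReal.ofReal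
      (Real.pi ^ (Module.finrank ℝ V / 2 : ℝ) * Real.Gamma (a - Module.finrank ℝ V / 2) /
        Real.Gamma a) := by
  have ha0 : 0 < a := lt_of_le_of_lt (by positivity) ha
  have hΓ := Real.Gamma_pos_of_pos ha0
  have hmeas : Measurable fun p : V × ℝ =>
      ENNReal.ofReal (p.2 ^ (a - 1) * Real.exp (-((1 + ‖p.1‖ ^ 2) * p.2))) := by fun_prop
  rw [ENNReal.ofReal_div_of_pos hΓ, ENNReal.eq_div_iff (by simpa using hΓ) ENNReal.ofReal_ne_top,
    ← lintegral_const_mul' _ _ ENNReal.ofReal_ne_top]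
  calc ∫⁻ v : V, ENNReal.ofReal (Real.Gamma a) * ENNReal.ofReal ((1 + ‖v‖ ^ 2) ^ (-a))
      = ∫⁻ v : V, ∫⁻ t in Set.Ioi (0 : ℝ),
          ENNReal.ofReal (t ^ (a - 1) * Real.exp (-((1 + ‖v‖ ^ 2) * t))) := by
        refine lintegral_congr fun v => ?_
        rw [lintegral_rpow_mul_exp_neg_mul_Ioi ha0 (by positivity), mul_comm,
          ENNReal.ofReal_mul (by positivity)]
    _ = ∫⁻ t in Set.Ioi (0 : ℝ), ∫⁻ v : V,
          ENNReal.ofReal (t ^ (a - 1) * Real.exp (-((1 + ‖v‖ ^ 2) * t))) :=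
        lintegral_lintegral_swap hmeas.aemeasurable
    _ = ∫⁻ t in Set.Ioi (0 : ℝ), ENNReal.ofReal (Real.pi ^ (Module.finrank ℝ V / 2 : ℝ)) *
          ENNReal.ofReal (t ^ (a - Module.finrank ℝ V / 2 - 1) * Real.exp (-(1 * t))) :=
        setLIntegral_congr_fun measurableSet_Ioi fun t ht =>
          lintegral_rpow_mul_exp_neg_one_add_norm_sq_mul a ht
    _ = ENNReal.ofReal (Real.pi ^ (Module.finrank ℝ V / 2 : ℝ) *
          Real.Gamma (a - Module.finrank ℝ V / 2)) := by
        rw [lintegral_const_mul' _ _ ENNReal.ofReal_ne_top,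
          lintegral_rpow_mul_exp_neg_mul_Ioi (sub_pos.2 ha) one_pos, Real.one_rpow, one_mul,
          ← ENNReal.ofReal_mul (by positivity)]

end InnerProductSpace

variable {ι : Type*} [Fintype ι]

theorem lintegral_one_add_dotProduct_rpow_neg {a : ℝ} (ha : (Fintype.card ι : ℝ) / 2 < a) :
    ∫⁻ v : ι → ℝ, ENNReal.ofReal ((1 + v ⬝ᵥ v) ^ (-a)) = ENNReal.ofReal
      (Real.pi ^ (Fintype.card ι / 2 : ℝ) * Real.Gamma (a - Fintype.card ι / 2) /
        Real.Gamma a) := by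
  have hnorm : ∀ v : EuclideanSpace ℝ ι, ‖v‖ ^ 2 = v.ofLp ⬝ᵥ v.ofLp := fun v => by
    rw [EuclideanSpace.real_norm_sq_eq]
    simp only [dotProduct, sq]
  rw [← finrank_euclideanSpace (𝕜 := ℝ) (ι := ι)] at ha ⊢
  rw [← lintegral_one_add_norm_sq_rpow_neg ha,
    ← (PiLp.volume_preserving_ofLp ι).lintegral_comp (by fun_prop)]
  simp only [hnorm]

variable [DecidableEq ι]

theorem measurable_ofReal_det_rpow {α : Type*} [TopologicalSpace α] [MeasurableSpace α]
    [BorelSpace α] {f : α → Matrix ι ι ℝ} (hf : Continuous f) (b : ℝ) :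
    Measurable fun x => ENNReal.ofReal ((f x).det ^ b) :=
  (hf.matrix_det.measurable.pow_const b).ennreal_ofReal

theorem lintegral_det_add_vecMulVec_rpow_neg {a : ℝ} (ha : (Fintype.card ι : ℝ) / 2 < a)
    {A : Matrix ι ι ℝ} (hA : A.PosDef) :
    ∫⁻ v : ι → ℝ, ENNReal.ofReal ((A + Matrix.vecMulVec v v).det ^ (-a)) =
      ENNReal.ofReal (A.det ^ (1 / 2 - a) *
        (Real.pi ^ (Fintype.card ι / 2 : ℝ) * Real.Gamma (a - Fintype.card ι / 2) /
          Real.Gamma a)) := by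
  have hA0 := hA.det_pos
  obtain ⟨g, hg, rfl⟩ := exists_isUnit_det_eq_mul_transpose hA
  have hmeas : Measurable fun v : ι → ℝ =>
      ENNReal.ofReal ((g * gᵀ + Matrix.vecMulVec v v).det ^ (-a)) :=
    measurable_ofReal_det_rpow (by fun_prop) _
  have hsubst : ∀ u : ι → ℝ,
      ENNReal.ofReal ((g * gᵀ + Matrix.vecMulVec (g *ᵥ u) (g *ᵥ u)).det ^ (-a)) =
        ENNReal.ofReal ((g * gᵀ).det ^ (-a)) * ENNReal.ofReal ((1 + u ⬝ᵥ u) ^ (-a)) := fun u => by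
    have hu : 0 ≤ 1 + u ⬝ᵥ u :=
      add_nonneg zero_le_one (Finset.sum_nonneg fun i _ => mul_self_nonneg (u i))
    rw [det_add_vecMulVec_mulVec, Real.mul_rpow hA0.le hu, ENNReal.ofReal_mul (by positivity)]
  have habs : |g.det| = (g * gᵀ).det ^ (1 / 2 : ℝ) := by
    simpa using abs_det_pow_eq_rpow_det_mul_transpose g 1
  rw [lintegral_comp_linearMap volume (f := Matrix.toLin' g)
    (by rw [LinearMap.det_toLin']; exact hg.ne_zero) hmeas]
  simp only [Matrix.toLin'_apply, hsubst, LinearMap.det_toLin']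
  rw [lintegral_const_mul' _ _ ENNReal.ofReal_ne_top, lintegral_one_add_dotProduct_rpow_neg ha,
    ← ENNReal.ofReal_mul (by positivity), ← ENNReal.ofReal_mul (by positivity), habs, ← mul_assoc,
    ← Real.rpow_add hA0, ← sub_eq_add_neg]

end StudentIntegral
section MatrixTIntegral

theorem multiGamma_succ (p : ℕ) (z : ℝ) :
    multiGamma (p + 1) z =
      Real.pi ^ ((p : ℝ) / 2) * Real.Gamma z * multiGamma p (z - 1 / 2) := by
  have hshift : ∀ i : ℕ, Real.Gamma (z - (i + 1 : ℕ) / 2) = Real.Gamma (z - 1 / 2 - i / 2) :=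
    fun i => by push_cast; ring_nf
  have hpi : Real.pi ^ (((p + 1 : ℕ) : ℝ) * ((p + 1 : ℕ) - 1) / 4) =
      Real.pi ^ ((p : ℝ) / 2) * Real.pi ^ ((p : ℝ) * (p - 1) / 4) := by
    rw [← Real.rpow_add Real.pi_pos]
    push_cast
    ring_nf
  simp only [multiGamma, Finset.prod_range_succ', hshift, hpi, Nat.cast_zero, zero_div, sub_zero]
  ring

theorem multiGamma_pos {p : ℕ} {z : ℝ} (hz : ((p : ℝ) - 1) / 2 < z) : 0 < multiGamma p z := by
  refine mul_pos (by positivity) (Finset.prod_pos fun i hi => Real.Gamma_pos_of_pos ?_)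
  have hip : (i : ℝ) + 1 ≤ p := mod_cast Finset.mem_range.1 hi
  linarith

/-- The integral of `|I + X'X|^(-a)` over the real `k × d` matrices `X`, in closed form. -/
noncomputable def tNormalizer (d k : ℕ) (a : ℝ) : ℝ :=
  Real.pi ^ ((d : ℝ) * k / 2) * multiGamma k (a - d / 2) / multiGamma k a

theorem tNormalizer_zero (d : ℕ) (a : ℝ) : tNormalizer d 0 a = 1 := by
  simp [tNormalizer, multiGamma]

theorem tNormalizer_succ (d k : ℕ) (a : ℝ) :
    tNormalizer d (k + 1) a =
      Real.pi ^ ((d : ℝ) / 2) * Real.Gamma (a - d / 2) / Real.Gamma a *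
        tNormalizer d k (a - 1 / 2) := by
  have hpi : Real.pi ^ ((d : ℝ) * (k + 1 : ℕ) / 2) =
      Real.pi ^ ((d : ℝ) / 2) * Real.pi ^ ((d : ℝ) * k / 2) := by
    rw [← Real.rpow_add Real.pi_pos]
    push_cast
    ring_nf
  have hk : Real.pi ^ ((k : ℝ) / 2) ≠ 0 := by positivity
  rw [tNormalizer, tNormalizer, multiGamma_succ, multiGamma_succ, hpi, sub_right_comm a]
  field_simp

theorem tNormalizer_pos {d k : ℕ} {a : ℝ} (ha : ((d : ℝ) + k - 1) / 2 < a) :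
    0 < tNormalizer d k a :=
  div_pos (mul_pos (by positivity) (multiGamma_pos (by linarith)))
    (multiGamma_pos (by linarith [d.cast_nonneg (α := ℝ)]))

theorem lintegral_fin_cons {E : Type*} [MeasureSpace E] [SigmaFinite (volume : Measure E)] {k : ℕ}
    {F : (Fin (k + 1) → E) → ℝ≥0∞} (hF : Measurable F) :
    ∫⁻ X, F X = ∫⁻ X : Fin k → E, ∫⁻ v, F (Fin.cons v X) := by
  have hcons := (volume_preserving_piFinSuccAbove (fun _ : Fin (k + 1) => E) 0).symm
  rw [← hcons.lintegral_comp_emb (MeasurableEquiv.measurableEmbedding _), Measure.volume_eq_prod]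
  refine (lintegral_prod_symm' _ (hF.comp hcons.measurable)).trans ?_
  simp only [Function.comp_apply, MeasurableEquiv.piFinSuccAbove_symm_apply,
    Fin.insertNthEquiv_zero]
  rfl

variable {ι : Type*}

theorem transpose_mul_self_cons {R : Type*} [CommSemiring R] {k : ℕ} (v : ι → R)
    (X : Fin k → ι → R) :
    (Matrix.of (Fin.cons v X : Fin (k + 1) → ι → R))ᵀ *
        Matrix.of (Fin.cons v X : Fin (k + 1) → ι → R) =
      (Matrix.of X)ᵀ * Matrix.of X + Matrix.vecMulVec v v := by
  ext i j
  simp [Matrix.mul_apply, Fin.sum_univ_succ, Matrix.vecMulVec_apply, add_comm]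

theorem posDef_add_transpose_mul_self {κ : Type*} [Finite ι] [Fintype κ] {A : Matrix ι ι ℝ}
    (hA : A.PosDef) (X : Matrix κ ι ℝ) : (A + Xᵀ * X).PosDef := by
  have hX := Matrix.posSemidef_conjTranspose_mul_self X
  rw [Matrix.conjTranspose_eq_transpose_of_trivial] at hX
  exact hA.add_posSemidef hX

theorem lintegral_det_add_transpose_mul_self_rpow_neg [Fintype ι] [DecidableEq ι]
    {A : Matrix ι ι ℝ} (hA : A.PosDef) (k : ℕ) {a : ℝ}
    (ha : ((Fintype.card ι : ℝ) + k - 1) / 2 < a) :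
    ∫⁻ X : Fin k → ι → ℝ, ENNReal.ofReal ((A + (Matrix.of X)ᵀ * Matrix.of X).det ^ (-a)) =
      ENNReal.ofReal (A.det ^ ((k : ℝ) / 2 - a) * tNormalizer (Fintype.card ι) k a) := by
  induction k generalizing a with
  | zero => simp [volume_pi, tNormalizer_zero]
  | succ k ih =>
    push_cast at ha
    have hrow : ∀ X : Fin k → ι → ℝ,
        ∫⁻ v : ι → ℝ, ENNReal.ofReal ((A + (Matrix.of (Fin.cons v X : Fin (k + 1) → ι → ℝ))ᵀ *
            Matrix.of (Fin.cons v X : Fin (k + 1) → ι → ℝ)).det ^ (-a)) =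
          ENNReal.ofReal ((A + (Matrix.of X)ᵀ * Matrix.of X).det ^ (-(a - 1 / 2))) *
            ENNReal.ofReal (Real.pi ^ (Fintype.card ι / 2 : ℝ) *
              Real.Gamma (a - Fintype.card ι / 2) / Real.Gamma a) := fun X => by
      have hX := posDef_add_transpose_mul_self hA (Matrix.of X)
      simp only [transpose_mul_self_cons, ← add_assoc]
      rw [lintegral_det_add_vecMulVec_rpow_neg (by linarith [k.cast_nonneg (α := ℝ)]) hX, neg_sub,
        ENNReal.ofReal_mul (Real.rpow_nonneg hX.det_pos.le _)]
    have hpos : 0 < A.det ^ ((k : ℝ) / 2 - (a - 1 / 2)) := Real.rpow_pos_of_pos hA.det_pos _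
    have hT := tNormalizer_pos (d := Fintype.card ι) (k := k) (a := a - 1 / 2) (by linarith)
    rw [lintegral_fin_cons (measurable_ofReal_det_rpow (by fun_prop) _)]
    simp only [hrow]
    rw [lintegral_mul_const' _ _ ENNReal.ofReal_ne_top, ih (by linarith),
      ← ENNReal.ofReal_mul (by positivity), tNormalizer_succ]
    push_cast
    ring_nf

variable {m n : ℕ}

/-- The unnormalized density of the matrix variate t distribution, for rectangular matrices and as
a function of the centred variable: `a` is the exponent, `S₁` and `S₂` are the row and column
scales. -/
noncomputable def matrixTKernel (a : ℝ) (S₁ : Matrix (Fin m) (Fin m) ℝ)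
    (S₂ : Matrix (Fin n) (Fin n) ℝ) (X : Matrix (Fin m) (Fin n) ℝ) : ℝ :=
  (1 + S₁⁻¹ * X * S₂⁻¹ * Xᵀ).det ^ (-a)

theorem measurable_ofReal_matrixTKernel (a : ℝ) (S₁ : Matrix (Fin m) (Fin m) ℝ)
    (S₂ : Matrix (Fin n) (Fin n) ℝ) :
    Measurable fun X => ENNReal.ofReal (matrixTKernel a S₁ S₂ X) :=
  measurable_ofReal_det_rpow (by fun_prop) _

theorem lintegral_matrixTKernel {a : ℝ} (ha : ((n : ℝ) + m - 1) / 2 < a)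
    {S₁ : Matrix (Fin m) (Fin m) ℝ} {S₂ : Matrix (Fin n) (Fin n) ℝ} (hS₁ : S₁.PosDef)
    (hS₂ : S₂.PosDef) :
    ∫⁻ X, ENNReal.ofReal (matrixTKernel a S₁ S₂ X) =
      ENNReal.ofReal (S₁.det ^ ((n : ℝ) / 2) * S₂.det ^ ((m : ℝ) / 2) * tNormalizer n m a) := by
  have hp₁ := hS₁.det_pos
  have hp₂ := hS₂.det_pos
  obtain ⟨g, hg, rfl⟩ := exists_isUnit_det_eq_mul_transpose hS₁
  have hsubst : ∀ Z : Matrix (Fin m) (Fin n) ℝ,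
      ENNReal.ofReal (matrixTKernel a (g * gᵀ) S₂ (g * Z)) =
        ENNReal.ofReal (S₂.det ^ a) * ENNReal.ofReal ((S₂ + Zᵀ * Z).det ^ (-a)) := fun Z => by
    have hdet := det_one_add_mul_inv_mul_transpose_mul_left hg hp₂.ne'.isUnit Z
    have hZ := (posDef_add_transpose_mul_self hS₂ Z).det_pos
    rw [← ENNReal.ofReal_mul (by positivity), matrixTKernel, eq_div_of_mul_eq hp₂.ne' hdet,
      Real.div_rpow hZ.le hp₂.le, Real.rpow_neg hp₂.le, div_inv_eq_mul, mul_comm]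
  have hZ : ∫⁻ Z : Matrix (Fin m) (Fin n) ℝ, ENNReal.ofReal ((S₂ + Zᵀ * Z).det ^ (-a)) =
      ENNReal.ofReal (S₂.det ^ ((m : ℝ) / 2 - a) * tNormalizer n m a) := by
    simpa only [Fintype.card_fin] using!
      lintegral_det_add_transpose_mul_self_rpow_neg hS₂ m (by rwa [Fintype.card_fin])
  rw [lintegral_mul_left hg (measurable_ofReal_matrixTKernel a _ S₂)]
  simp only [hsubst]
  rw [lintegral_const_mul' _ _ ENNReal.ofReal_ne_top, hZ, ← ENNReal.ofReal_mul (by positivity),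
    ← ENNReal.ofReal_mul (by positivity), abs_det_pow_eq_rpow_det_mul_transpose,
    ← mul_assoc (S₂.det ^ a), ← Real.rpow_add hp₂, add_sub_cancel, mul_assoc]

theorem lintegral_comp_sub_right (F : Matrix (Fin m) (Fin n) ℝ → ℝ≥0∞)
    (B : Matrix (Fin m) (Fin n) ℝ) : ∫⁻ X, F (X - B) = ∫⁻ X, F X :=
  lintegral_sub_right_eq_self (μ := (volume : Measure (Fin m → Fin n → ℝ))) F B

theorem matrixTPDF_eq (ν : ℝ) (B : Matrix (Fin n) (Fin n) ℝ) {S₁ S₂ : Matrix (Fin n) (Fin n) ℝ}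
    (hS₁ : S₁.PosDef) (hS₂ : S₂.PosDef) (X : Matrix (Fin n) (Fin n) ℝ) :
    matrixTPDF ν B S₁ S₂ X =
      (S₁.det ^ ((n : ℝ) / 2) * S₂.det ^ ((n : ℝ) / 2) *
          tNormalizer n n ((ν + 2 * (n : ℝ) - 1) / 2))⁻¹ *
        matrixTKernel ((ν + 2 * (n : ℝ) - 1) / 2) S₁ S₂ (X - B) := by
  have hshift : (ν + 2 * (n : ℝ) - 1) / 2 - n / 2 = (ν + n - 1) / 2 := by ring
  rw [matrixTPDF, matrixTKernel, tNormalizer, hshift, neg_div, neg_div,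
    Real.rpow_neg hS₁.det_pos.le, Real.rpow_neg hS₂.det_pos.le, ← sq, mul_inv, mul_inv, inv_div]
  ring

theorem matrixT_eq_withDensity {ν : ℝ} (hν : 0 < ν) (B : Matrix (Fin n) (Fin n) ℝ)
    {S₁ S₂ : Matrix (Fin n) (Fin n) ℝ} (hS₁ : S₁.PosDef) (hS₂ : S₂.PosDef) :
    matrixT ν B S₁ S₂ = volume.withDensity fun X =>
      (∫⁻ Z, ENNReal.ofReal (matrixTKernel ((ν + 2 * (n : ℝ) - 1) / 2) S₁ S₂ (Z - B)))⁻¹ *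
        ENNReal.ofReal (matrixTKernel ((ν + 2 * (n : ℝ) - 1) / 2) S₁ S₂ (X - B)) := by
  have hp₁ := hS₁.det_pos
  have hp₂ := hS₂.det_pos
  have ha : ((n : ℝ) + n - 1) / 2 < (ν + 2 * (n : ℝ) - 1) / 2 := by linarith
  have hT := tNormalizer_pos ha
  rw [matrixT, lintegral_comp_sub_right fun Z => ENNReal.ofReal (matrixTKernel _ S₁ S₂ Z),
    lintegral_matrixTKernel ha hS₁ hS₂, ← ENNReal.ofReal_inv_of_pos (by positivity)]
  simp only [matrixTPDF_eq ν B hS₁ hS₂]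
  congr with X
  exact ENNReal.ofReal_mul (by positivity)

end MatrixTIntegral
section InverseGamma

variable {n : ℕ}

theorem measurable_matrix_inv : Measurable fun w : Matrix (Fin n) (Fin n) ℝ => w⁻¹ := by
  refine measurable_pi_iff.2 fun i => measurable_pi_iff.2 fun j => ?_
  have hdet : Continuous fun w : Matrix (Fin n) (Fin n) ℝ => w.det := by fun_prop
  have hadj : Continuous fun w : Matrix (Fin n) (Fin n) ℝ => w.adjugate i j :=
    (Continuous.matrix_adjugate continuous_id).matrix_elem i j
  simp only [Matrix.inv_def, Ring.inverse_eq_inv', Matrix.smul_apply, smul_eq_mul]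
  exact hdet.measurable.inv.mul hadj.measurable

/-- The unnormalized density of the inverted matrix variate gamma distribution `IMG_n(a, β, Ψ)`,
for positive definite arguments. -/
noncomputable def invGammaKernel (a β : ℝ) (Ψ w : Matrix (Fin n) (Fin n) ℝ) : ℝ :=
  w.det ^ (-a - ((n : ℝ) + 1) / 2) * Real.exp (-(1 / β) * (Ψ * w⁻¹).trace)

theorem invMatrixGammaPDF_eq (δ β : ℝ) (Ψ w : Matrix (Fin n) (Fin n) ℝ) :
    invMatrixGammaPDF δ β Ψ w =
      Ψ.det ^ δ / (β ^ ((n : ℝ) * δ) * multiGamma n δ) * invGammaKernel δ β Ψ w :=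
  mul_assoc _ _ _

theorem measurable_invGammaKernel (a β : ℝ) (Ψ : Matrix (Fin n) (Fin n) ℝ) :
    Measurable (invGammaKernel a β Ψ) := by
  have hdet : Continuous fun w : Matrix (Fin n) (Fin n) ℝ => w.det := by fun_prop
  have htr : Continuous fun v : Matrix (Fin n) (Fin n) ℝ => -(1 / β) * (Ψ * v).trace := by
    fun_prop
  exact (hdet.measurable.pow_const _).mul (htr.measurable.comp measurable_matrix_inv).exp

theorem measurable_invMatrixGammaPDF (δ β : ℝ) (Ψ : Matrix (Fin n) (Fin n) ℝ) :
    Measurable (invMatrixGammaPDF δ β Ψ) := by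
  simp only [funext (invMatrixGammaPDF_eq δ β Ψ)]
  exact (measurable_invGammaKernel δ β Ψ).const_mul _

theorem measurable_matrixNormalPDF (M Ω₂ : Matrix (Fin n) (Fin n) ℝ) :
    Measurable fun p : Matrix (Fin n) (Fin n) ℝ × Matrix (Fin n) (Fin n) ℝ =>
      matrixNormalPDF M p.1 Ω₂ p.2 := by
  have hdet : Continuous fun p : Matrix (Fin n) (Fin n) ℝ × Matrix (Fin n) (Fin n) ℝ =>
    p.1.det := by fun_prop
  have htr : Continuous fun p : Matrix (Fin n) (Fin n) ℝ × Matrix (Fin n) (Fin n) ℝ =>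
    -(1 / 2) * (Ω₂⁻¹ * (p.2 - M)ᵀ * p.1 * (p.2 - M)).trace := by fun_prop
  exact (((hdet.measurable.pow_const _).mul_const _).div_const _).mul
    (htr.measurable.comp ((measurable_matrix_inv.comp measurable_fst).prodMk measurable_snd)).exp

theorem invGammaKernel_congr (a β : ℝ) {g : Matrix (Fin n) (Fin n) ℝ} (hg : IsUnit g.det)
    {w : Matrix (Fin n) (Fin n) ℝ} (hw : w.PosDef) :
    invGammaKernel a β (g * gᵀ) (g * w * gᵀ) =
      (g * gᵀ).det ^ (-a - ((n : ℝ) + 1) / 2) * invGammaKernel a β 1 w := by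
  have hgt : IsUnit gᵀ.det := by rwa [Matrix.det_transpose]
  have htr : (g * gᵀ * (g * w * gᵀ)⁻¹).trace = (1 * w⁻¹).trace := by
    rw [Matrix.mul_inv_rev, Matrix.mul_inv_rev, Matrix.mul_assoc,
      Matrix.mul_nonsing_inv_cancel_left _ _ hgt, ← Matrix.mul_assoc, Matrix.trace_mul_comm,
      Matrix.nonsing_inv_mul_cancel_left _ _ hg, Matrix.one_mul]
  have hdet : (g * w * gᵀ).det = (g * gᵀ).det * w.det := by
    simp only [Matrix.det_mul]
    ring
  have hggt : 0 ≤ (g * gᵀ).det := by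
    rw [Matrix.det_mul, Matrix.det_transpose]
    exact mul_self_nonneg _
  rw [invGammaKernel, invGammaKernel, htr, hdet, Real.mul_rpow hggt hw.det_pos.le, mul_assoc]

/-- The total mass of `invGammaKernel a β Ψ` over the positive definite cone. It enters only through
its dependence on `Ψ`; whether it is finite is left open. -/
noncomputable def invGammaIntegral (a β : ℝ) (Ψ : Matrix (Fin n) (Fin n) ℝ) : ℝ≥0∞ :=
  ∫⁻ w in {w | w.PosDef}, ENNReal.ofReal (invGammaKernel a β Ψ w) ∂symVolume n

theorem invGammaIntegral_eq (a β : ℝ) {Ψ : Matrix (Fin n) (Fin n) ℝ} (hΨ : Ψ.PosDef) :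
    invGammaIntegral a β Ψ = ENNReal.ofReal (Ψ.det ^ (-a)) *
      invGammaIntegral a β (1 : Matrix (Fin n) (Fin n) ℝ) := by
  have hpos := hΨ.det_pos
  obtain ⟨g, hg, rfl⟩ := exists_isUnit_det_eq_mul_transpose hΨ
  calc invGammaIntegral a β (g * gᵀ)
      = ENNReal.ofReal (|g.det| ^ (n + 1)) * ∫⁻ w in {w | w.PosDef},
          ENNReal.ofReal (invGammaKernel a β (g * gᵀ) (g * w * gᵀ)) ∂symVolume n :=
        setLIntegral_posDef_symVolume_congr hg (measurable_invGammaKernel a β _).ennreal_ofReal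
    _ = ENNReal.ofReal (|g.det| ^ (n + 1)) *
          (ENNReal.ofReal ((g * gᵀ).det ^ (-a - ((n : ℝ) + 1) / 2)) *
            invGammaIntegral a β (1 : Matrix (Fin n) (Fin n) ℝ)) := by
        congr 1
        rw [invGammaIntegral, ← lintegral_const_mul' _ _ ENNReal.ofReal_ne_top]
        refine setLIntegral_congr_fun measurableSet_posDef fun w hw => ?_
        rw [invGammaKernel_congr a β hg hw, ENNReal.ofReal_mul (by positivity)]
    _ = ENNReal.ofReal ((g * gᵀ).det ^ (-a)) *
          invGammaIntegral a β (1 : Matrix (Fin n) (Fin n) ℝ) := by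
        rw [← mul_assoc, ← ENNReal.ofReal_mul (by positivity),
          abs_det_pow_eq_rpow_det_mul_transpose, ← Real.rpow_add hpos]
        push_cast
        ring_nf

end InverseGamma

section Mixture

variable {n : ℕ}

theorem posDef_add_mul_inv_mul_transpose {ι κ : Type*} [Finite ι] [Fintype κ] [DecidableEq κ]
    {S₁ : Matrix ι ι ℝ} {S₂ : Matrix κ κ ℝ} (hS₁ : S₁.PosDef) (hS₂ : S₂.PosDef)
    (X : Matrix ι κ ℝ) : (S₁ + X * S₂⁻¹ * Xᵀ).PosDef := by
  have hX := hS₂.inv.posSemidef.mul_mul_conjTranspose_same X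
  rw [Matrix.conjTranspose_eq_transpose_of_trivial] at hX
  exact hS₁.add_posSemidef hX

theorem rpow_neg_det_add_mul_inv_mul_transpose {m n : ℕ} (a : ℝ) {S₁ : Matrix (Fin m) (Fin m) ℝ}
    {S₂ : Matrix (Fin n) (Fin n) ℝ} (hS₁ : S₁.PosDef) (hS₂ : S₂.PosDef)
    (X : Matrix (Fin m) (Fin n) ℝ) :
    (S₁ + X * S₂⁻¹ * Xᵀ).det ^ (-a) = S₁.det ^ (-a) * matrixTKernel a S₁ S₂ X := by
  have hp₁ := hS₁.det_pos
  have hX := (posDef_add_mul_inv_mul_transpose hS₁ hS₂ X).det_pos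
  have hdet := det_add_eq_det_mul_det_one_add_inv_mul hp₁.ne'.isUnit (X * S₂⁻¹ * Xᵀ)
  rw [← Matrix.mul_assoc, ← Matrix.mul_assoc] at hdet
  rw [hdet] at hX ⊢
  rw [Real.mul_rpow hp₁.le (pos_of_mul_pos_right hX hp₁.le).le, matrixTKernel]

theorem invMatrixGammaPDF_mul_matrixNormalPDF (δ : ℝ) (B S₁ S₂ y : Matrix (Fin n) (Fin n) ℝ)
    {w : Matrix (Fin n) (Fin n) ℝ} (hw : w.PosDef) :
    invMatrixGammaPDF δ 2 S₁ w * matrixNormalPDF B w S₂ y =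
      S₁.det ^ δ / (2 ^ ((n : ℝ) * δ) * multiGamma n δ) *
          (S₂.det ^ (-(n : ℝ) / 2) / (2 * Real.pi) ^ ((n : ℝ) ^ 2 / 2)) *
        invGammaKernel (δ + n / 2) 2 (S₁ + (y - B) * S₂⁻¹ * (y - B)ᵀ) w := by
  have htr : ((S₁ + (y - B) * S₂⁻¹ * (y - B)ᵀ) * w⁻¹).trace =
      (S₁ * w⁻¹).trace + (S₂⁻¹ * (y - B)ᵀ * w⁻¹ * (y - B)).trace := by
    rw [Matrix.add_mul, Matrix.trace_add, Matrix.trace_mul_comm (S₂⁻¹ * (y - B)ᵀ * w⁻¹)]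
    simp only [Matrix.mul_assoc]
  have hexp : -(δ + (n : ℝ) / 2) - ((n : ℝ) + 1) / 2 =
      (-δ - ((n : ℝ) + 1) / 2) + (-(n : ℝ) / 2) := by ring
  rw [invGammaKernel, htr, mul_add, Real.exp_add, hexp, Real.rpow_add hw.det_pos,
    invMatrixGammaPDF, matrixNormalPDF]
  ring

theorem exists_setLIntegral_invMatrixGammaPDF_mul_matrixNormalPDF {δ : ℝ}
    (hδ : ((n : ℝ) - 1) / 2 < δ) (B : Matrix (Fin n) (Fin n) ℝ) {S₁ S₂ : Matrix (Fin n) (Fin n) ℝ}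
    (hS₁ : S₁.PosDef) (hS₂ : S₂.PosDef) :
    ∃ K : ℝ≥0∞, ∀ y, ∫⁻ w in {w | w.PosDef}, ENNReal.ofReal (invMatrixGammaPDF δ 2 S₁ w) *
        ENNReal.ofReal (matrixNormalPDF B w S₂ y) ∂symVolume n =
      K * ENNReal.ofReal (matrixTKernel (δ + n / 2) S₁ S₂ (y - B)) := by
  have hp₁ := hS₁.det_pos
  have hp₂ := hS₂.det_pos
  have hΓ := multiGamma_pos hδ
  set c : ℝ := S₁.det ^ δ / (2 ^ ((n : ℝ) * δ) * multiGamma n δ) *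
    (S₂.det ^ (-(n : ℝ) / 2) / (2 * Real.pi) ^ ((n : ℝ) ^ 2 / 2))
  have hc0 : 0 ≤ c := by positivity
  refine ⟨ENNReal.ofReal c * (ENNReal.ofReal (S₁.det ^ (-(δ + n / 2))) *
    invGammaIntegral (δ + n / 2) 2 (1 : Matrix (Fin n) (Fin n) ℝ)), fun y => ?_⟩
  have hkernel : ∀ w : Matrix (Fin n) (Fin n) ℝ, w.PosDef →
      ENNReal.ofReal (invMatrixGammaPDF δ 2 S₁ w) * ENNReal.ofReal (matrixNormalPDF B w S₂ y) =
        ENNReal.ofReal c * ENNReal.ofReal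
          (invGammaKernel (δ + n / 2) 2 (S₁ + (y - B) * S₂⁻¹ * (y - B)ᵀ) w) := fun w hw => by
    have hpw := hw.det_pos
    have hpdf : 0 ≤ invMatrixGammaPDF δ 2 S₁ w := by
      rw [invMatrixGammaPDF]
      positivity
    rw [← ENNReal.ofReal_mul hpdf, ← ENNReal.ofReal_mul hc0,
      invMatrixGammaPDF_mul_matrixNormalPDF δ B S₁ S₂ y hw]
  rw [setLIntegral_congr_fun measurableSet_posDef hkernel,
    lintegral_const_mul' _ _ ENNReal.ofReal_ne_top, ← invGammaIntegral,
    invGammaIntegral_eq _ _ (posDef_add_mul_inv_mul_transpose hS₁ hS₂ (y - B)),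
    rpow_neg_det_add_mul_inv_mul_transpose _ hS₁ hS₂,
    ENNReal.ofReal_mul (p := S₁.det ^ (-(δ + (n : ℝ) / 2))) (by positivity)]
  ring

theorem map_eq_withDensity_lintegral_of_condDistrib {Ω α β : Type*} [MeasurableSpace Ω]
    {P : Measure Ω} [IsFiniteMeasure P] [MeasurableSpace α] [MeasurableSpace β]
    [StandardBorelSpace β] [Nonempty β] {X : Ω → α} {Y : Ω → β} {μ : Measure α} [SFinite μ]
    {ν : Measure β} [SFinite ν] {f : α → ℝ≥0∞} {g : α → β → ℝ≥0∞} (hf : Measurable f)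
    (hg : Measurable (Function.uncurry g)) (hX : HasLaw X (μ.withDensity f) P)
    (hY : AEMeasurable Y P) (hYX : ∀ᵐ x ∂(P.map X), condDistrib Y X P x = ν.withDensity (g x)) :
    P.map Y = ν.withDensity fun y => ∫⁻ x, f x * g x y ∂μ := by
  ext s hs
  have hgs : ∀ x, ν.withDensity (g x) s = ∫⁻ y in s, g x y ∂ν := fun x => withDensity_apply _ hs
  have hgm : Measurable fun x => ∫⁻ y in s, g x y ∂ν := hg.lintegral_prod_right'
  calc P.map Y s
      = ∫⁻ x, condDistrib Y X P x s ∂(P.map X) := by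
        rw [← condDistrib_comp_map hX.aemeasurable hY,
          Measure.bind_apply hs (Kernel.aemeasurable _)]
    _ = ∫⁻ x, ∫⁻ y in s, g x y ∂ν ∂(P.map X) := by
        refine lintegral_congr_ae ?_
        filter_upwards [hYX] with x hx
        rw [hx, hgs]
    _ = ∫⁻ x, ∫⁻ y in s, f x * g x y ∂ν ∂μ := by
        rw [hX.map_eq, lintegral_withDensity_eq_lintegral_mul _ hf hgm]
        exact lintegral_congr fun x =>
          (lintegral_const_mul (f x) (hg.comp measurable_prodMk_left)).symm
    _ = ∫⁻ y in s, ∫⁻ x, f x * g x y ∂μ ∂ν :=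
        lintegral_lintegral_swap ((hf.comp measurable_fst).mul hg).aemeasurable
    _ = ν.withDensity (fun y => ∫⁻ x, f x * g x y ∂μ) s := (withDensity_apply _ hs).symm

theorem eq_inv_lintegral_of_isProbabilityMeasure_withDensity {α : Type*} [MeasurableSpace α]
    {μ : Measure α} {c : ℝ≥0∞} {f : α → ℝ≥0∞} (hf : Measurable f)
    (h : IsProbabilityMeasure (μ.withDensity fun x => c * f x)) : c = (∫⁻ x, f x ∂μ)⁻¹ := by
  have hone := h.measure_univ
  rw [withDensity_apply _ MeasurableSet.univ, Measure.restrict_univ, lintegral_const_mul _ hf]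
    at hone
  exact ENNReal.eq_inv_of_mul_eq_one_left hone

end Mixture

end MatrixT

theorem theorem1 {Ω : Type*} [MeasurableSpace Ω] (P : Measure Ω) [IsProbabilityMeasure P]
    (n : ℕ) (ν : ℝ) (hν : 0 < ν)
    (B S₁ S₂ : Matrix (Fin n) (Fin n) ℝ) (hS₁ : S₁.PosDef) (hS₂ : S₂.PosDef)
    (W Y : Ω → Matrix (Fin n) (Fin n) ℝ)
    (hW : HasLaw W (MatrixT.invMatrixGamma ((ν + (n : ℝ) - 1) / 2) 2 S₁) P)
    (hY : AEMeasurable Y P)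
    (hYW : ∀ᵐ w ∂(P.map W), condDistrib Y W P w = MatrixT.matrixNormal B w S₂) :
    HasLaw Y (MatrixT.matrixT ν B S₁ S₂) P := by
  have ha : (ν + (n : ℝ) - 1) / 2 + n / 2 = (ν + 2 * (n : ℝ) - 1) / 2 := by ring
  obtain ⟨K, hK⟩ := MatrixT.exists_setLIntegral_invMatrixGammaPDF_mul_matrixNormalPDF
    (δ := (ν + (n : ℝ) - 1) / 2) (by linarith) B hS₁ hS₂
  simp only [ha] at hK
  have hmap : P.map Y = volume.withDensity fun y => K * ENNReal.ofReal
      (MatrixT.matrixTKernel ((ν + 2 * (n : ℝ) - 1) / 2) S₁ S₂ (y - B)) := by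
    simp only [← hK]
    exact MatrixT.map_eq_withDensity_lintegral_of_condDistrib
      (MatrixT.measurable_invMatrixGammaPDF _ _ _).ennreal_ofReal
      (MatrixT.measurable_matrixNormalPDF B S₂).ennreal_ofReal hW hY hYW
  have hprob := hmap ▸ Measure.isProbabilityMeasure_map (μ := P) hY
  have hker := (MatrixT.measurable_ofReal_matrixTKernel ((ν + 2 * (n : ℝ) - 1) / 2) S₁ S₂).comp
    (measurable_id.sub_const B)
  refine ⟨hY, ?_⟩
  rw [hmap, MatrixT.matrixT_eq_withDensity hν B hS₁ hS₂,
    MatrixT.eq_inv_lintegral_of_isProbabilityMeasure_withDensity hker hprob]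
  rfl
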